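/- Let $k$ be a field of characteristic zero, and let $W=k^2$ have standard basis $e_1,e_2$. Put $V_1=\mathrm{Sym}^4W$ with basis $m_i=e_1^{4-i}e_2^{i}$ $(0\le i\le 4)$, $V_2=\mathrm{Sym}^2W$ with basis $l_i=e_1^{2-i}e_2^{i}$ $(0\le i\le 2)$, and $V=\wedge^2V_1\otimes V_2$. Using these bases, let the algebraic $k$-group $G=\mathrm{GL}(V_1)\times\mathrm{GL}(V_2)=\mathrm{GL}(5)\times\mathrm{GL}(3)$ act on $V$ in the natural way. Let $$w=(m_0\wedge m_3-3\,m_1\wedge m_2)\otimes l_2+(-m_0\wedge m_4+2\,m_1\wedge m_3)\otimes l_1+(m_1\wedge m_4-3\,m_2\wedge m_3)\otimes l_0\in V,$$ let $G_w\subset G$ be its stabilizer (a closed $k$-subgroup), and let $G_w^0$ be the connected component of the identity of $G_w$ in the Zariski topology, an open subgroup scheme of $G_w$. Let $\mathrm{GL}(2)$ act on $V_1$ by $g\cdot x=(\det g)^{-2}\,\mathrm{Sym}^4(g)x$ and on $V_2$ by $g\cdot x=(\det g)^{-1}\,\mathrm{Sym}^2(g)x$. Scalar matrices act trivially, so this defines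 a homomorphism $\rho:\mathrm{PGL}(2)\to G$. Let $\tilde T=\{(tI_5,t^{-2}I_3)\mid t\in\mathrm{GL}(1)\}\subset G$. Then $\rho$ is an embedding, by which we regard $\mathrm{PGL}(2)$ as a subgroup of $G$; the map $t\mapsto(tI_5,t^{-2}I_3)$ is an isomorphism $\mathrm{GL}(1)\cong\tilde T$; the subgroups $\mathrm{PGL}(2)$ and $\tilde T$ commute and have trivial intersection; and $$G_w^0=\mathrm{PGL}(2)\times\tilde T$$ as algebraic subgroups of $G$ over $k$. That is, for every commutative $k$-algebra $R$, $G_w^0(R)$ is the internal direct product of the subgroups $\mathrm{PGL}(2)(R)$ and $\tilde T(R)$ of $G(R)$. In particular, if $R$ is a field or a local ring, then $G_w^0(R)=\rho(\mathrm{GL}_2(R)/R^\times)\cdot\tilde T(R)$. -/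

import Mathlib

open scoped TensorProduct MatrixGroups

noncomputable section

namespace GLFiveGLThree

/-! ### Symmetric powers of the standard representation of `GL(2)` -/

section Sym

variable {R : Type*} [CommRing R]

/-- The exponent of the monomial `e₁ ^ (d - i) * e₂ ^ i`. -/
def symExp (d i : ℕ) : Fin 2 →₀ ℕ :=
  Finsupp.single 0 (d - i) + Finsupp.single 1 i

/-- The basis vector `e₁ ^ (d - i) * e₂ ^ i` of `Sym^d W`, where `W = R²` has basis
`e₁ = X 0`, `e₂ = X 1` and the symmetric algebra of `W` is `R[e₁, e₂]`. -/
def symMon (R : Type*) [CommRing R] (d i : ℕ) : MvPolynomial (Fin 2) R :=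
  MvPolynomial.X 0 ^ (d - i) * MvPolynomial.X 1 ^ i

/-- The action of a `2 × 2` matrix `g` on the symmetric algebra of `W`:
`e₁ ↦ g₁₁ e₁ + g₂₁ e₂`, `e₂ ↦ g₁₂ e₁ + g₂₂ e₂`. -/
def symSubst (g : Matrix (Fin 2) (Fin 2) R) :
    MvPolynomial (Fin 2) R →ₐ[R] MvPolynomial (Fin 2) R :=
  MvPolynomial.aeval fun i => ∑ j, MvPolynomial.C (g j i) * MvPolynomial.X j

/-- The matrix of the usual action of `g` on `Sym^d W` in the basis
`e₁ ^ d, e₁ ^ (d - 1) e₂, …, e₂ ^ d`. -/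
def symMatrix (d : ℕ) (g : Matrix (Fin 2) (Fin 2) R) :
    Matrix (Fin (d + 1)) (Fin (d + 1)) R :=
  Matrix.of fun j i => MvPolynomial.coeff (symExp d j) (symSubst g (symMon R d i))

theorem symMon_eq (d i : ℕ) : symMon R d i = MvPolynomial.monomial (symExp d i) 1 := by
  simp only [symMon, symExp, MvPolynomial.X_pow_eq_monomial, MvPolynomial.monomial_mul, mul_one]

theorem symExp_inj {d i j : ℕ} (h : symExp d i = symExp d j) : i = j := by
  simpa [symExp] using DFunLike.congr_fun h 1

theorem symSubst_one : symSubst (1 : Matrix (Fin 2) (Fin 2) R) = AlgHom.id R _ := by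
  ext i : 1
  fin_cases i <;> simp [symSubst, Fin.sum_univ_two]

theorem symSubst_mul (g h : Matrix (Fin 2) (Fin 2) R) :
    symSubst (g * h) = (symSubst g).comp (symSubst h) := by
  ext i : 1
  simp only [symSubst, MvPolynomial.aeval_X, AlgHom.comp_apply, map_mul,
    Fin.sum_univ_two, Matrix.mul_apply, map_add, MvPolynomial.aeval_C,
    MvPolynomial.algebraMap_eq]
  ring

theorem symSubst_homogeneous (g : Matrix (Fin 2) (Fin 2) R) (d : ℕ) (i : Fin (d + 1)) :
    (symSubst g (symMon R d i)).IsHomogeneous d := by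
  have h : ∀ l : Fin 2, (symSubst g (MvPolynomial.X l)).IsHomogeneous 1 := by
    intro l
    simp only [symSubst, MvPolynomial.aeval_X]
    refine MvPolynomial.IsHomogeneous.sum _ _ _ fun j _ => ?_
    simpa using (MvPolynomial.isHomogeneous_C (Fin 2) (g j l)).mul
      (MvPolynomial.isHomogeneous_X R j)
  have h2 := ((h 0).pow (d - i)).mul ((h 1).pow i)
  have hd : 1 * (d - (i : ℕ)) + 1 * (i : ℕ) = d := by have := i.2; omega
  rw [hd] at h2
  simpa [symMon] using h2

theorem symSubst_symMon (g : Matrix (Fin 2) (Fin 2) R) (d : ℕ) (i : Fin (d + 1)) :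
    symSubst g (symMon R d i) = ∑ j, MvPolynomial.C (symMatrix d g j i) * symMon R d j := by
  ext s
  simp only [symMon_eq, MvPolynomial.coeff_sum, MvPolynomial.coeff_C_mul,
    MvPolynomial.coeff_monomial]
  by_cases hs : s 0 + s 1 = d
  · have hs' : symExp d (s 1) = s := by
      ext l
      fin_cases l
      · simp [symExp]; omega
      · simp [symExp]
    have hlt : s 1 < d + 1 := by omega
    rw [Finset.sum_eq_single (⟨s 1, hlt⟩ : Fin (d + 1))]
    · simp [hs', symMatrix, symMon_eq]
    · intro b _ hb
      have : symExp d b ≠ s := by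
        intro h
        exact hb (Fin.ext (symExp_inj (h.trans hs'.symm)))
      simp [this]
    · simp
  · have h0 : MvPolynomial.coeff s (symSubst g (symMon R d i)) = 0 := by
      refine (symSubst_homogeneous g d i).coeff_eq_zero ?_
      simpa [Finsupp.degree_eq_sum, Fin.sum_univ_two] using hs
    rw [symMon_eq] at h0
    rw [h0, Finset.sum_eq_zero]
    intro j _
    have : symExp d j ≠ s := by
      intro h
      apply hs
      rw [← h]
      have := j.2
      simp [symExp]
      omega
    simp [this]

theorem symMatrix_one (d : ℕ) : symMatrix d (1 : Matrix (Fin 2) (Fin 2) R) = 1 := by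
  ext j i
  simp only [symMatrix, Matrix.of_apply, symSubst_one, AlgHom.id_apply, symMon_eq,
    MvPolynomial.coeff_monomial, Matrix.one_apply]
  refine if_congr ⟨fun h => (Fin.ext (symExp_inj h)).symm, fun h => by rw [h]⟩ rfl rfl

theorem symMatrix_mul (d : ℕ) (g h : Matrix (Fin 2) (Fin 2) R) :
    symMatrix d (g * h) = symMatrix d g * symMatrix d h := by
  ext l i
  have e : symMatrix d (g * h) l i =
      MvPolynomial.coeff (symExp d l) (symSubst (g * h) (symMon R d i)) := rfl
  rw [e, symSubst_mul, AlgHom.comp_apply, symSubst_symMon h, map_sum, MvPolynomial.coeff_sum,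
    Matrix.mul_apply]
  refine Finset.sum_congr rfl fun j _ => ?_
  rw [map_mul, MvPolynomial.C_eq_smul_one, map_smul, map_one, smul_mul_assoc, one_mul,
    MvPolynomial.coeff_smul, smul_eq_mul, mul_comm]
  rfl

theorem symMatrix_map {S : Type*} [CommRing S] (f : R →+* S) (d : ℕ)
    (g : Matrix (Fin 2) (Fin 2) R) :
    symMatrix d (g.map f) = (symMatrix d g).map f := by
  ext j i
  simp only [symMatrix, Matrix.of_apply, Matrix.map_apply, symMon, symSubst, map_mul, map_pow,
    MvPolynomial.aeval_X, Fin.sum_univ_two, ← MvPolynomial.coeff_map, map_add,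
    MvPolynomial.map_C, MvPolynomial.map_X]

theorem symMatrix_scalar (d : ℕ) (a : R) :
    symMatrix d (Matrix.scalar (Fin 2) a) = Matrix.scalar (Fin (d + 1)) (a ^ d) := by
  ext j i
  have h : symSubst (Matrix.scalar (Fin 2) a) (symMon R d i) =
      MvPolynomial.C (a ^ d) * symMon R d i := by
    have hd : a ^ d = a ^ (d - (i : ℕ)) * a ^ (i : ℕ) := by
      rw [← pow_add]; congr 1; have := i.2; omega
    rw [hd]
    simp [symSubst, symMon, Matrix.scalar_apply, Fin.sum_univ_two, mul_pow]
    ring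
  have e : symMatrix d (Matrix.scalar (Fin 2) a) j i = MvPolynomial.coeff (symExp d j)
      (symSubst (Matrix.scalar (Fin 2) a) (symMon R d i)) := rfl
  rw [e, h, MvPolynomial.coeff_C_mul, symMon_eq, MvPolynomial.coeff_monomial,
    Matrix.scalar_apply, Matrix.diagonal_apply]
  by_cases hij : j = i
  · subst hij; simp
  · have : symExp d i ≠ symExp d j := fun h => hij (Fin.ext (symExp_inj h)).symm
    simp [hij, this]

/-- `Sym^d` of the standard representation of `GL(2)`, as a homomorphism to `GL(d + 1)`. -/
def symGL (R : Type*) [CommRing R] (d : ℕ) : GL (Fin 2) R →* GL (Fin (d + 1)) R :=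
  Units.map
    { toFun := symMatrix d
      map_one' := symMatrix_one d
      map_mul' := symMatrix_mul d }

/-- The twisted action `g · x = (det g)^{-n} g x` on `Sym^d W`. -/
def twistedSym (R : Type*) [CommRing R] (d n : ℕ) : GL (Fin 2) R →* GL (Fin (d + 1)) R where
  toFun g := Matrix.GeneralLinearGroup.scalar _ ((Matrix.GeneralLinearGroup.det g)⁻¹ ^ n) *
    symGL R d g
  map_one' := by simp
  map_mul' g h := by
    have hc := Matrix.GeneralLinearGroup.scalar_commute
      ((Matrix.GeneralLinearGroup.det h)⁻¹ ^ n) (symGL R d g)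
    rw [map_mul, map_mul, mul_inv, mul_pow, map_mul, mul_assoc, mul_assoc, ← mul_assoc _ _
      (symGL R d h), hc, mul_assoc]

/-- Scalar matrices act trivially on `Sym^{2n} W` twisted by `det^{-n}`. -/
theorem twistedSym_scalar {d n : ℕ} (hd : d = 2 * n) (u : Rˣ) :
    twistedSym R d n (Matrix.GeneralLinearGroup.scalar (Fin 2) u) = 1 := by
  have h1 : symGL R d (Matrix.GeneralLinearGroup.scalar (Fin 2) u) =
      Matrix.GeneralLinearGroup.scalar _ (u ^ d) :=
    Units.ext (symMatrix_scalar d (u : R))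
  have h2 : Matrix.GeneralLinearGroup.det (Matrix.GeneralLinearGroup.scalar (Fin 2) u) =
      u ^ 2 := by
    ext; simp
  change Matrix.GeneralLinearGroup.scalar _ _ * _ = 1
  rw [h1, h2, hd, ← map_mul, ← inv_pow, ← pow_mul, inv_pow, inv_mul_cancel, map_one]

theorem twistedSym_map {S : Type*} [CommRing S] (f : R →+* S) (d n : ℕ) (g : GL (Fin 2) R) :
    twistedSym S d n (Matrix.GeneralLinearGroup.map f g) =
      Matrix.GeneralLinearGroup.map f (twistedSym R d n g) := by
  have h1 : symGL S d (Matrix.GeneralLinearGroup.map f g) =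
      Matrix.GeneralLinearGroup.map f (symGL R d g) :=
    Units.ext (symMatrix_map f d (g : Matrix (Fin 2) (Fin 2) R))
  have h2 : ∀ u : Rˣ, Matrix.GeneralLinearGroup.map f
      (Matrix.GeneralLinearGroup.scalar (Fin (d + 1)) u) =
      Matrix.GeneralLinearGroup.scalar _ (Units.map (f : R →* S) u) := by
    intro u
    ext i j
    simp [Matrix.scalar_apply, Matrix.diagonal_apply, apply_ite f]
  have h3 : (Matrix.GeneralLinearGroup.det (Matrix.GeneralLinearGroup.map f g))⁻¹ ^ n =
      Units.map (f : R →* S) ((Matrix.GeneralLinearGroup.det g)⁻¹ ^ n) := by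
    rw [map_pow, map_inv, Matrix.GeneralLinearGroup.map_det]
  change Matrix.GeneralLinearGroup.scalar _ _ * _ =
    Matrix.GeneralLinearGroup.map f (Matrix.GeneralLinearGroup.scalar _ _ * _)
  rw [map_mul, h1, h2, h3]

end Sym

/-! ### The group `G`, the representation `V` and the point `w` -/

/-- The `R`-points of `G = GL(5) × GL(3)`. -/
abbrev G (R : Type*) [CommRing R] : Type _ := GL (Fin 5) R × GL (Fin 3) R

/-- The `R`-points of `V = ⋀² V₁ ⊗ V₂`, with `V₁ = R⁵` and `V₂ = R³`. -/
abbrev V (R : Type*) [CommRing R] : Type _ := (⋀[R]^2 (Fin 5 → R)) ⊗[R] (Fin 3 → R)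

/-- The natural action of `G` on `V`. -/
def rep (R : Type*) [CommRing R] : Representation R (G R) (V R) where
  toFun g := TensorProduct.map
    (exteriorPower.map 2 (Matrix.toLin' (g.1 : Matrix (Fin 5) (Fin 5) R)))
    (Matrix.toLin' (g.2 : Matrix (Fin 3) (Fin 3) R))
  map_one' := by
    simp only [Prod.fst_one, Prod.snd_one, Units.val_one, Matrix.toLin'_one,
      exteriorPower.map_id, TensorProduct.map_id]
    rfl
  map_mul' g h := by
    simp only [Prod.fst_mul, Prod.snd_mul, Units.val_mul, Matrix.toLin'_mul,
      exteriorPower.map_comp, TensorProduct.map_comp]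
    rfl

/-- The map on points of `G` induced by a ring homomorphism. -/
def mapG {R S : Type*} [CommRing R] [CommRing S] (f : R →+* S) : G R →* G S :=
  (Matrix.GeneralLinearGroup.map f).prodMap (Matrix.GeneralLinearGroup.map f)

/-- `mᵢ ∧ mⱼ`, where `m₀, …, m₄` is the standard basis of `V₁` (corresponding to the basis
`mᵢ = e₁ ^ (4 - i) e₂ ^ i` of `Sym⁴ W`). -/
def mWedge (R : Type*) [CommRing R] (i j : Fin 5) : ⋀[R]^2 (Fin 5 → R) :=
  exteriorPower.ιMulti R 2 ![Pi.single i 1, Pi.single j 1]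

/-- The standard basis `l₀, l₁, l₂` of `V₂` (corresponding to the basis
`lᵢ = e₁ ^ (2 - i) e₂ ^ i` of `Sym² W`). -/
def lVec (R : Type*) [CommRing R] (i : Fin 3) : Fin 3 → R := Pi.single i 1

/-- `w = (m₀∧m₃ - 3 m₁∧m₂) ⊗ l₂ + (-m₀∧m₄ + 2 m₁∧m₃) ⊗ l₁ + (m₁∧m₄ - 3 m₂∧m₃) ⊗ l₀`. -/
def w (R : Type*) [CommRing R] : V R :=
  (mWedge R 0 3 - (3 : R) • mWedge R 1 2) ⊗ₜ[R] lVec R 2 +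
    (-mWedge R 0 4 + (2 : R) • mWedge R 1 3) ⊗ₜ[R] lVec R 1 +
    (mWedge R 1 4 - (3 : R) • mWedge R 2 3) ⊗ₜ[R] lVec R 0

/-- The `R`-points of the stabilizer `G_w`. -/
def stabilizerW (R : Type*) [CommRing R] : Subgroup (G R) where
  carrier := {g | rep R g (w R) = w R}
  one_mem' := by simp
  mul_mem' {g h} hg hh := by
    change rep R (g * h) (w R) = w R
    rw [map_mul, Module.End.mul_apply, show rep R h (w R) = w R from hh]
    exact hg
  inv_mem' {g} hg := by
    calc rep R g⁻¹ (w R) = rep R g⁻¹ (rep R g (w R)) := by rw [show rep R g (w R) = w R from hg]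
      _ = w R := by simp

/-! ### The identity component of the algebraic group `G_w`

`G` is the open subscheme of the affine space with coordinate ring `CoordRing k` on which both
generic matrices are invertible, and `G_w` is a closed subscheme of `G`. Their underlying spaces
carry the subspace topology of the Zariski topology of the affine space. -/

/-- The coordinate ring of the space of pairs of a `5 × 5` and a `3 × 3` matrix. -/
abbrev CoordRing (k : Type*) [CommRing k] : Type _ :=
  MvPolynomial ((Fin 5 × Fin 5) ⊕ (Fin 3 × Fin 3)) k

/-- Evaluation of coordinate functions at an `R`-point of `G`. -/
def evalAt (k : Type*) [Field k] {R : Type*} [CommRing R] [Algebra k R] (g : G R) :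
    CoordRing k →ₐ[k] R :=
  MvPolynomial.aeval (Sum.elim (fun ij => g.1 ij.1 ij.2) (fun ij => g.2 ij.1 ij.2))

/-- The underlying topological space of `G_w`: the points `x` of the affine space for which the
tautological point with values in the residue field `κ(x)` is an element of `G_w(κ(x))`. -/
def stabilizerSpace (k : Type*) [Field k] : Set (PrimeSpectrum (CoordRing k)) :=
  {x | ∃ g ∈ stabilizerW x.asIdeal.ResidueField,
    ∀ f : CoordRing k, evalAt k g f = algebraMap (CoordRing k) x.asIdeal.ResidueField f}

/-- The identity of `G`, as a point of the affine space. -/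
def identityPoint (k : Type*) [Field k] : PrimeSpectrum (CoordRing k) :=
  PrimeSpectrum.comap (evalAt k (1 : G k)).toRingHom ⊥

/-- The underlying space of `G_w^0`: the connected component of the identity in `G_w`. -/
def identityComponentSpace (k : Type*) [Field k] : Set (PrimeSpectrum (CoordRing k)) :=
  connectedComponentIn (stabilizerSpace k) (identityPoint k)

/-- The `R`-points of the open subscheme `G_w^0` of `G_w`: those `R`-points `Spec R → G_w` whose
image is contained in the connected component of the identity. -/
def identityComponent (k : Type*) [Field k] (R : Type*) [CommRing R] [Algebra k R] :
    Set (G R) :=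
  {g | g ∈ stabilizerW R ∧ ∀ p : PrimeSpectrum R,
    PrimeSpectrum.comap (evalAt k g).toRingHom p ∈ identityComponentSpace k}

/-! ### The subgroups `PGL(2)` and `T̃` of `G` -/

/-- The homomorphism `GL(2) → G` given by the twisted actions on `Sym⁴ W` and `Sym² W`. -/
def rhoGL (R : Type*) [CommRing R] : GL (Fin 2) R →* G R :=
  (twistedSym R 4 2).prod (twistedSym R 2 1)

theorem rhoGL_scalar (R : Type*) [CommRing R] (u : Rˣ) :
    rhoGL R (Matrix.GeneralLinearGroup.scalar (Fin 2) u) = 1 := by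
  have h1 := twistedSym_scalar (d := 4) (n := 2) (by norm_num) u
  have h2 := twistedSym_scalar (d := 2) (n := 1) (by norm_num) u
  rw [rhoGL, MonoidHom.prod_apply, h1, h2]
  rfl

/-- The homomorphism `PGL(2, R) → G(R)` induced by `rhoGL`. -/
def rhoPGL (R : Type*) [CommRing R] : PGL(2, R) →* G R :=
  Matrix.ProjGenLinGroup.lift (rhoGL R) (MonoidHom.ext (rhoGL_scalar R))

theorem rhoGL_map {R S : Type*} [CommRing R] [CommRing S] (f : R →+* S) (h : GL (Fin 2) R) :
    rhoGL S (Matrix.GeneralLinearGroup.map f h) = mapG f (rhoGL R h) :=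
  Prod.ext (twistedSym_map f 4 2 h) (twistedSym_map f 2 1 h)

theorem exists_rhoPGL_map {R S : Type*} [CommRing R] [CommRing S] (f : R →+* S) (x : PGL(2, R)) :
    ∃ y : PGL(2, S), rhoPGL S y = mapG f (rhoPGL R x) := by
  obtain ⟨h, rfl⟩ := Matrix.ProjGenLinGroup.mk_surjective x
  exact ⟨.mk (Matrix.GeneralLinearGroup.map f h), rhoGL_map f h⟩

theorem away_refine_left {R : Type*} [CommRing R] (f f' : R) (g : G R)
    (h : ∃ x, mapG (algebraMap R (Localization.Away f)) g = rhoPGL _ x) :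
    ∃ x, mapG (algebraMap R (Localization.Away (f * f'))) g = rhoPGL _ x := by
  obtain ⟨x, hx⟩ := h
  let φ : Localization.Away f →+* Localization.Away (f * f') :=
    IsLocalization.Away.awayToAwayRight f f'
  have hφ : φ.comp (algebraMap R _) = algebraMap R _ :=
    RingHom.ext fun a => IsLocalization.Away.awayToAwayRight_eq f f' a
  obtain ⟨y, hy⟩ := exists_rhoPGL_map φ x
  refine ⟨y, ?_⟩
  rw [hy, ← hx, ← hφ]
  rfl

theorem away_refine_right {R : Type*} [CommRing R] (f f' : R) (g : G R)
    (h : ∃ x, mapG (algebraMap R (Localization.Away f')) g = rhoPGL _ x) :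
    ∃ x, mapG (algebraMap R (Localization.Away (f * f'))) g = rhoPGL _ x := by
  rw [mul_comm]
  exact away_refine_left f' f g h

/-- The `R`-points of the algebraic subgroup `PGL(2)` of `G`. The algebraic group
`PGL(2) = GL(2) / GL(1)` is the Zariski sheaf associated with `R ↦ GL₂(R) / Rˣ`
(`GL(1)`-torsors are locally trivial in the Zariski topology), so that an `R`-point of `G` belongs
to `PGL(2)` if and only if, locally on `Spec R`, it is the image of a class of an invertible
`2 × 2` matrix. -/
def pglSubgroup (R : Type*) [CommRing R] : Subgroup (G R) where
  carrier := {g | ∀ p : PrimeSpectrum R, ∃ f : R, f ∉ p.asIdeal ∧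
    ∃ x : PGL(2, Localization.Away f),
      mapG (algebraMap R (Localization.Away f)) g = rhoPGL (Localization.Away f) x}
  one_mem' p := ⟨1, p.isPrime.one_notMem, 1, by simp⟩
  mul_mem' {g h} hg hh p := by
    obtain ⟨f, hf, hx⟩ := hg p
    obtain ⟨f', hf', hx'⟩ := hh p
    obtain ⟨x, hx⟩ := away_refine_left f f' g hx
    obtain ⟨x', hx'⟩ := away_refine_right f f' h hx'
    exact ⟨f * f', p.isPrime.mul_notMem hf hf', x * x', by rw [map_mul, map_mul, hx, hx']⟩
  inv_mem' {g} hg p := by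
    obtain ⟨f, hf, x, hx⟩ := hg p
    exact ⟨f, hf, x⁻¹, by rw [map_inv, map_inv, hx]⟩

/-- The homomorphism `GL(1) → G`, `t ↦ (t I₅, t⁻² I₃)`. -/
def tauT (R : Type*) [CommRing R] : Rˣ →* G R :=
  (Matrix.GeneralLinearGroup.scalar (Fin 5)).prod
    ((Matrix.GeneralLinearGroup.scalar (Fin 3)).comp (zpowGroupHom (-2)))

/-- The `R`-points of the subgroup `T̃ = {(t I₅, t⁻² I₃)}` of `G`. -/
def torusSubgroup (R : Type*) [CommRing R] : Subgroup (G R) := (tauT R).range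

end GLFiveGLThree

end

/-! Write `w = ∑ₗ ωₗ ⊗ lₗ`; then `(g, h)` fixes `w` iff `g (∑ₘ hₗₘ ωₘ) gᵀ = ωₗ` for all `l`, with
the bivectors viewed as skew-symmetric matrices. The relation `ω₁ ∧ ω₁ = 4 ω₀ ∧ ω₂` in `⋀⁴ V₁`
forces `h` to preserve the discriminant of binary quadratic forms up to a factor. Hence wherever
`h₀₀` is invertible, `h` is a multiple of some `Sym² x`, and a Weyl element reduces the case of
`h₂₀` to it; no prime contains both entries. After division by `ρ(x)` the component `h` is scalar,
and a Schur type argument shows that `(g, h)` lies in `T̃`.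

These local factorizations glue because the character `(g, h) ↦ (det g · det h)⁻¹` is trivial on
`PGL(2)` and the identity on `T̃ ≅ GL(1)`, so that it computes the `T̃`-component globally.
Finally, every point of `G_w` over a field is a specialization of the image of the generic point of
`GL(2) × GL(1)`, so that `G_w` is irreducible and `G_w^0 = G_w`. -/

open scoped Matrix

noncomputable section

namespace GLFiveGLThree

section SymmetricPowers

variable {R : Type*} [CommRing R]

theorem symMatrix_apply_of_expansion {d : ℕ} {g : Matrix (Fin 2) (Fin 2) R} {i : Fin (d + 1)}
    (c : Fin (d + 1) → R)
    (h : symSubst g (symMon R d i) = ∑ j, MvPolynomial.C (c j) * symMon R d j)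
    (j : Fin (d + 1)) : symMatrix d g j i = c j := by
  have coeff_symMon (b : Fin (d + 1)) :
      MvPolynomial.coeff (symExp d j) (symMon R d b) = if b = j then 1 else 0 := by
    rw [symMon_eq, MvPolynomial.coeff_monomial]
    exact if_congr ⟨fun h => Fin.ext (symExp_inj h), fun h => by rw [h]⟩ rfl rfl
  rw [symMatrix, Matrix.of_apply, h, MvPolynomial.coeff_sum]
  simp [MvPolynomial.coeff_C_mul, coeff_symMon]

/-- The matrix of `!![p, q; r, s]` on `Sym² W`. -/
def symTwo (p q r s : R) : Matrix (Fin 3) (Fin 3) R :=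
  !![p ^ 2, p * q, q ^ 2;
     2 * p * r, p * s + q * r, 2 * q * s;
     r ^ 2, r * s, s ^ 2]

/-- The matrix of `!![p, q; r, s]` on `Sym⁴ W`. -/
def symFour (p q r s : R) : Matrix (Fin 5) (Fin 5) R :=
  !![p ^ 4, p ^ 3 * q, p ^ 2 * q ^ 2, p * q ^ 3, q ^ 4;
     4 * p ^ 3 * r, p ^ 3 * s + 3 * p ^ 2 * q * r, 2 * p ^ 2 * q * s + 2 * p * q ^ 2 * r,
       3 * p * q ^ 2 * s + q ^ 3 * r, 4 * q ^ 3 * s;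
     6 * p ^ 2 * r ^ 2, 3 * p ^ 2 * r * s + 3 * p * q * r ^ 2,
       p ^ 2 * s ^ 2 + 4 * p * q * r * s + q ^ 2 * r ^ 2,
       3 * p * q * s ^ 2 + 3 * q ^ 2 * r * s, 6 * q ^ 2 * s ^ 2;
     4 * p * r ^ 3, 3 * p * r ^ 2 * s + q * r ^ 3, 2 * p * r * s ^ 2 + 2 * q * r ^ 2 * s,
       p * s ^ 3 + 3 * q * r * s ^ 2, 4 * q * s ^ 3;
     r ^ 4, r ^ 3 * s, r ^ 2 * s ^ 2, r * s ^ 3, s ^ 4]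

theorem symSubst_symMon_of (p q r s : R) (d i : ℕ) :
    symSubst !![p, q; r, s] (symMon R d i) =
      (MvPolynomial.C p * MvPolynomial.X 0 + MvPolynomial.C r * MvPolynomial.X 1) ^ (d - i) *
        (MvPolynomial.C q * MvPolynomial.X 0 + MvPolynomial.C s * MvPolynomial.X 1) ^ i := by
  simp [symSubst, symMon, Fin.sum_univ_two]

theorem symMatrix_two (p q r s : R) : symMatrix 2 !![p, q; r, s] = symTwo p q r s := by
  ext j i
  rw [symMatrix_apply_of_expansion fun j => symTwo p q r s j i]
  rw [symSubst_symMon_of, Fin.sum_univ_three]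
  fin_cases i <;>
  · simp only [symTwo, symMon, Fin.isValue, Fin.reduceFinMk, Fin.mk_one, Fin.zero_eta,
      Fin.coe_ofNat_eq_mod, Nat.reduceSub, Matrix.of_apply, Matrix.cons_val',
      Matrix.cons_val, map_mul, map_add, map_pow, map_ofNat MvPolynomial.C]
    ring

theorem symMatrix_four (p q r s : R) : symMatrix 4 !![p, q; r, s] = symFour p q r s := by
  ext j i
  rw [symMatrix_apply_of_expansion fun j => symFour p q r s j i]
  rw [symSubst_symMon_of, Fin.sum_univ_five]
  fin_cases i <;>
  · simp only [symFour, symMon, Fin.isValue, Fin.reduceFinMk, Fin.mk_one, Fin.zero_eta,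
      Fin.coe_ofNat_eq_mod, Nat.reduceSub, Matrix.of_apply, Matrix.cons_val',
      Matrix.cons_val, map_mul, map_add, map_pow, map_ofNat MvPolynomial.C]
    ring

theorem rhoGL_fst (x : GL (Fin 2) R) :
    ((rhoGL R x).1 : Matrix (Fin 5) (Fin 5) R) =
      (((Matrix.GeneralLinearGroup.det x)⁻¹ ^ 2 : Rˣ) : R) •
        symFour (x 0 0) (x 0 1) (x 1 0) (x 1 1) := by
  rw [← symMatrix_four, ← Matrix.eta_fin_two]
  exact (Matrix.smul_eq_diagonal_mul (m := Fin 5) (symMatrix 4 x.1) _).symm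

theorem rhoGL_snd (x : GL (Fin 2) R) :
    ((rhoGL R x).2 : Matrix (Fin 3) (Fin 3) R) =
      (((Matrix.GeneralLinearGroup.det x)⁻¹ : Rˣ) : R) •
        symTwo (x 0 0) (x 0 1) (x 1 0) (x 1 1) := by
  rw [← symMatrix_two, ← Matrix.eta_fin_two, ← pow_one (Matrix.GeneralLinearGroup.det x)⁻¹]
  exact (Matrix.smul_eq_diagonal_mul (m := Fin 3) (symMatrix 2 x.1) _).symm

theorem tauT_fst (t : Rˣ) :
    ((tauT R t).1 : Matrix (Fin 5) (Fin 5) R) = (t : R) • (1 : Matrix (Fin 5) (Fin 5) R) := by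
  rw [Matrix.smul_one_eq_diagonal]; rfl

theorem tauT_snd (t : Rˣ) :
    ((tauT R t).2 : Matrix (Fin 3) (Fin 3) R) =
      ((t ^ (-2 : ℤ) : Rˣ) : R) • (1 : Matrix (Fin 3) (Fin 3) R) := by
  rw [Matrix.smul_one_eq_diagonal]; rfl

theorem tauT_commute (t : Rˣ) (g : G R) : tauT R t * g = g * tauT R t :=
  Prod.ext (Matrix.GeneralLinearGroup.scalar_commute _ _)
    (Matrix.GeneralLinearGroup.scalar_commute _ _)

end SymmetricPowers

section Bivectors

variable {R : Type*} [CommRing R] {n : Type*}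

theorem coe_ιMulti_pair {M : Type*} [AddCommGroup M] [Module R M] (u v : M) :
    (exteriorPower.ιMulti R 2 ![u, v] : ExteriorAlgebra R M) =
      ExteriorAlgebra.ι R u * ExteriorAlgebra.ι R v := by
  simp [ExteriorAlgebra.ιMulti_apply]

/-- The coordinate of a bivector at `eᵢ ∧ eⱼ`, defined without choosing an ordering of the indices
as the functional sending `u ∧ v` to the minor `uᵢ vⱼ - uⱼ vᵢ`. -/
def bivectorCoord (i j : n) : ⋀[R]^2 (n → R) →ₗ[R] R :=
  exteriorPower.alternatingMapLinearEquiv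
    ((Matrix.detRowAlternating (n := Fin 2) (R := R)).compLinearMap
      (LinearMap.funLeft R R ![i, j]))

theorem bivectorCoord_ιMulti (i j : n) (u v : n → R) :
    bivectorCoord i j (exteriorPower.ιMulti R 2 ![u, v]) = u i * v j - u j * v i := by
  rw [bivectorCoord, exteriorPower.alternatingMapLinearEquiv_apply_ιMulti]
  exact Matrix.det_fin_two (R := R) _

variable [Fintype n] [DecidableEq n] {ι : Type*} [Fintype ι] [DecidableEq ι]

/-- The bivector `∑ Aᵢⱼ eᵢ ∧ eⱼ` with coefficient matrix `A`, where the sum is over all pairs of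
indices, so that only `A - Aᵀ` matters. -/
def bivector : Matrix n n R →ₗ[R] ⋀[R]^2 (n → R) where
  toFun A := ∑ i, ∑ j, A i j • exteriorPower.ιMulti R 2 ![Pi.single i 1, Pi.single j 1]
  map_add' A B := by simp only [Matrix.add_apply, add_smul, Finset.sum_add_distrib]
  map_smul' c A := by
    simp only [Matrix.smul_apply, smul_assoc, Finset.smul_sum, RingHom.id_apply]

theorem bivector_apply (A : Matrix n n R) : bivector A =
    ∑ i, ∑ j, A i j • exteriorPower.ιMulti R 2 ![Pi.single i 1, Pi.single j 1] := rfl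

theorem bivector_single (i j : n) (c : R) : bivector (Matrix.single i j c) =
    c • exteriorPower.ιMulti R 2 ![Pi.single i 1, Pi.single j 1] := by
  simp [bivector_apply, Matrix.single_apply, ite_and]

theorem bivector_vecMulVec (u v : n → R) :
    bivector (Matrix.vecMulVec u v) = exteriorPower.ιMulti R 2 ![u, v] := by
  refine Subtype.ext ?_
  simp only [bivector_apply, Matrix.vecMulVec_apply, Submodule.coe_sum, Submodule.coe_smul,
    coe_ιMulti_pair]
  conv_rhs => rw [pi_eq_sum_univ' u, pi_eq_sum_univ' v]
  simp only [map_sum, map_smul, Finset.sum_mul_sum, smul_mul_smul_comm]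

theorem map_bivector {m : Type*} [Fintype m] [DecidableEq m] (g : Matrix m n R) (A : Matrix n n R) :
    exteriorPower.map 2 (Matrix.toLin' g) (bivector A) = bivector (g * A * gᵀ) := by
  induction A using Matrix.induction_on' with
  | h_zero => simp
  | h_add A B hA hB => simp only [map_add, hA, hB, Matrix.mul_add, Matrix.add_mul]
  | h_std_basis i j c =>
    rw [bivector_single, map_smul, exteriorPower.map_apply_ιMulti]
    have hcols : Matrix.toLin' g ∘ ![Pi.single i 1, Pi.single j 1] = ![g.col i, g.col j] := by
      ext a b; fin_cases a <;> simp
    rw [hcols, ← bivector_vecMulVec, ← map_smul]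
    congr 1
    ext a b
    simp [Matrix.mul_apply, Matrix.single_apply, Matrix.vecMulVec_apply, ite_and]
    ring

theorem bivectorCoord_bivector (i j : n) (A : Matrix n n R) :
    bivectorCoord i j (bivector A) = A i j - A j i := by
  simp [bivector_apply, bivectorCoord_ιMulti, Pi.single_apply, mul_sub]

theorem bivector_eq_zero_of_transpose_eq {A : Matrix n n R} (hA : Aᵀ = A) : bivector A = 0 := by
  refine Subtype.ext ?_
  simp only [bivector_apply, Submodule.coe_sum, Submodule.coe_smul, coe_ιMulti_pair,
    ← Finset.sum_product', Submodule.coe_zero]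
  refine Finset.sum_involution (fun p _ => p.swap) (fun p _ => ?_) (fun p _ hp h => hp ?_)
    (by simp) (by simp)
  · rw [Prod.fst_swap, Prod.snd_swap, ← Matrix.transpose_apply A, hA, ← smul_add,
      ExteriorAlgebra.ι_add_mul_swap, smul_zero]
  · rw [show p.2 = p.1 from congrArg Prod.fst h, ExteriorAlgebra.ι_sq_zero, smul_zero]

theorem bivector_eq_bivector_iff {A B : Matrix n n R} :
    bivector A = bivector B ↔ A - Aᵀ = B - Bᵀ := by
  constructor
  · intro h
    ext i j
    simpa only [bivectorCoord_bivector, Matrix.sub_apply, Matrix.transpose_apply] using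
      congrArg (bivectorCoord i j) h
  · intro h
    rw [← sub_eq_zero, ← map_sub]
    apply bivector_eq_zero_of_transpose_eq
    rw [Matrix.transpose_sub]
    exact (sub_eq_sub_iff_sub_eq_sub.1 h).symm

/-- The element `∑ₗ bₗ ⊗ eₗ` of `⋀² Rⁿ ⊗ R^ι` whose `l`-th coordinate `bₗ` is the bivector with
coefficient matrix `A l`. -/
def bivectorTensor (A : ι → Matrix n n R) : (⋀[R]^2 (n → R)) ⊗[R] (ι → R) :=
  ∑ l, bivector (A l) ⊗ₜ[R] Pi.single l 1

theorem map_bivectorTensor (g : Matrix n n R) (h : Matrix ι ι R) (A : ι → Matrix n n R) :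
    TensorProduct.map (exteriorPower.map 2 (Matrix.toLin' g)) (Matrix.toLin' h)
      (bivectorTensor A) = bivectorTensor fun l => g * (∑ m, h l m • A m) * gᵀ := by
  have hcol (m : ι) : Matrix.toLin' h (Pi.single m 1) = ∑ l, h l m • Pi.single l (1 : R) := by
    rw [Matrix.toLin'_apply, Matrix.mulVec_single_one]
    exact pi_eq_sum_univ' _
  simp only [bivectorTensor, map_sum, TensorProduct.map_tmul, map_bivector, hcol,
    TensorProduct.tmul_sum, TensorProduct.tmul_smul, Matrix.mul_sum, Matrix.sum_mul,
    Matrix.mul_smul, Matrix.smul_mul, map_smul, TensorProduct.sum_tmul, TensorProduct.smul_tmul']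
  exact Finset.sum_comm

theorem bivectorTensor_eq_iff {A B : ι → Matrix n n R} :
    bivectorTensor A = bivectorTensor B ↔ ∀ l, A l - (A l)ᵀ = B l - (B l)ᵀ := by
  have hcoord (A : ι → Matrix n n R) (l : ι) :
      TensorProduct.piScalarRight R R _ ι (bivectorTensor A) l = bivector (A l) := by
    simp [bivectorTensor, TensorProduct.piScalarRightHom_tmul, Pi.single_apply]
  rw [← (TensorProduct.piScalarRight R R _ ι).injective.eq_iff, funext_iff]
  simp only [hcoord, bivector_eq_bivector_iff]

end Bivectors

section Equations

variable {R S : Type*} [CommRing R] [CommRing S]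

/-- The skew-symmetric matrix whose entry `(i, j)`, `i < j`, is the coefficient of `mᵢ ∧ mⱼ` in
the image of `w` under the contraction with the linear form `lₗ ↦ cₗ` on `V₂`. -/
def skewNet (c : Fin 3 → R) : Matrix (Fin 5) (Fin 5) R :=
  !![0, 0, 0, c 2, -c 1;
     0, 0, -(3 * c 2), 2 * c 1, c 0;
     0, 3 * c 2, 0, -(3 * c 0), 0;
     -c 2, -(2 * c 1), 3 * c 0, 0, 0;
     c 1, -c 0, 0, 0, 0]

/-- The skew-symmetric coefficient matrix of the bivector `ωₗ`, where `w = ∑ₗ ωₗ ⊗ lₗ`. -/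
def skewW (R : Type*) [CommRing R] (l : Fin 3) : Matrix (Fin 5) (Fin 5) R :=
  skewNet (Pi.single l 1)

theorem skewNet_smul (a : R) (c : Fin 3 → R) : skewNet (a • c) = a • skewNet c := by
  ext i j
  fin_cases i <;> fin_cases j <;> simp [skewNet, mul_left_comm]

theorem skewNet_map (f : R →+* S) (c : Fin 3 → R) :
    (skewNet c).map f = skewNet fun l => f (c l) := by
  ext i j
  fin_cases i <;> fin_cases j <;> simp [skewNet, map_ofNat f]

theorem mul_skewNet_mul_transpose_apply {n : Type*} (g : Matrix n (Fin 5) R) (c : Fin 3 → R)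
    (i j : n) : (g * skewNet c * gᵀ) i j =
      c 0 * (g i 1 * g j 4 - g i 4 * g j 1 - 3 * (g i 2 * g j 3 - g i 3 * g j 2)) +
      c 1 * (2 * (g i 1 * g j 3 - g i 3 * g j 1) - (g i 0 * g j 4 - g i 4 * g j 0)) +
      c 2 * (g i 0 * g j 3 - g i 3 * g j 0 - 3 * (g i 1 * g j 2 - g i 2 * g j 1)) := by
  simp only [Matrix.mul_apply, Matrix.transpose_apply, Fin.sum_univ_five, skewNet,
    Matrix.of_apply, Matrix.cons_val', Matrix.cons_val]
  ring

/-- Upper triangular coefficient matrices of the coordinates of `w`. -/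
def upperW (R : Type*) [CommRing R] : Fin 3 → Matrix (Fin 5) (Fin 5) R :=
  ![Matrix.single 1 4 1 - (3 : R) • Matrix.single 2 3 1,
    -Matrix.single 0 4 1 + (2 : R) • Matrix.single 1 3 1,
    Matrix.single 0 3 1 - (3 : R) • Matrix.single 1 2 1]

theorem w_eq_bivectorTensor : w R = bivectorTensor (upperW R) := by
  simp only [w, mWedge, lVec, bivectorTensor, upperW, Fin.sum_univ_three, Matrix.cons_val,
    map_add, map_sub, map_neg, map_smul, bivector_single, one_smul]
  abel

theorem sum_smul_upperW_sub_transpose (c : Fin 3 → R) :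
    (∑ l, c l • upperW R l) - (∑ l, c l • upperW R l)ᵀ = skewNet c := by
  ext i j
  fin_cases i <;> fin_cases j <;> simp [Fin.sum_univ_three, upperW, skewNet, mul_comm]

/-- The skew-symmetric coefficient matrix of the `l`-th coordinate of `g w`. -/
def orbitMatrix (g : G R) (l : Fin 3) : Matrix (Fin 5) (Fin 5) R :=
  (g.1 : Matrix (Fin 5) (Fin 5) R) * skewNet (Pi.single l 1 ᵥ* (g.2 : Matrix (Fin 3) (Fin 3) R)) *
    (g.1 : Matrix (Fin 5) (Fin 5) R)ᵀ

theorem orbitMatrix_mapG (f : R →+* S) (g : G R) (l : Fin 3) :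
    orbitMatrix (mapG f g) l = (orbitMatrix g l).map f := by
  simp only [orbitMatrix, Matrix.map_mul, Matrix.transpose_map, skewNet_map,
    Matrix.single_one_vecMul]
  rfl

theorem mem_stabilizerW_iff {g : G R} :
    g ∈ stabilizerW R ↔ ∀ l, orbitMatrix g l = skewW R l := by
  have hrep : rep R g (w R) = bivectorTensor fun l => (g.1 : Matrix (Fin 5) (Fin 5) R) *
      (∑ m, (g.2 : Matrix (Fin 3) (Fin 3) R) l m • upperW R m) *
        (g.1 : Matrix (Fin 5) (Fin 5) R)ᵀ := by
    rw [w_eq_bivectorTensor]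
    exact map_bivectorTensor _ _ _
  change rep R g (w R) = w R ↔ _
  rw [hrep, w_eq_bivectorTensor, bivectorTensor_eq_iff]
  refine forall_congr' fun l => ?_
  have hW : upperW R l - (upperW R l)ᵀ = skewW R l := by
    rw [skewW, ← sum_smul_upperW_sub_transpose]
    simp [Pi.single_apply]
  rw [hW, orbitMatrix, Matrix.single_one_vecMul, ← sum_smul_upperW_sub_transpose (g.2.1.row l)]
  simp only [Matrix.row_apply, Matrix.transpose_mul, Matrix.transpose_transpose, Matrix.mul_sub,
    Matrix.sub_mul, Matrix.mul_assoc]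

theorem skewW_map (f : R →+* S) (l : Fin 3) :
    (skewW R l).map f = skewW S l := by
  rw [skewW, skewNet_map]
  congr 1
  ext m
  simp [Pi.single_apply, apply_ite f]

theorem mapG_mem_stabilizerW (f : R →+* S) {g : G R} (hg : g ∈ stabilizerW R) :
    mapG f g ∈ stabilizerW S := by
  rw [mem_stabilizerW_iff] at hg ⊢
  intro l
  rw [orbitMatrix_mapG, hg, skewW_map]

theorem mem_stabilizerW_of_mapG {f : R →+* S} (hf : Function.Injective f) {g : G R}
    (hg : mapG f g ∈ stabilizerW S) : g ∈ stabilizerW R := by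
  rw [mem_stabilizerW_iff] at hg ⊢
  intro l
  apply Matrix.map_injective hf
  beta_reduce
  rw [← orbitMatrix_mapG, hg, skewW_map]

theorem tauT_mem_stabilizerW (t : Rˣ) : tauT R t ∈ stabilizerW R := by
  rw [mem_stabilizerW_iff]
  intro l
  have ht : (t : R) * ((t ^ (-2 : ℤ) : Rˣ) * t) = 1 := by
    rw [← Units.val_mul, ← Units.val_mul, Units.val_eq_one]
    group
  simp only [orbitMatrix, tauT_fst, tauT_snd, Matrix.vecMul_smul, Matrix.vecMul_one, skewNet_smul,
    Matrix.transpose_smul, Matrix.transpose_one, Matrix.smul_mul, Matrix.mul_smul, Matrix.one_mul,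
    Matrix.mul_one, smul_smul, ht, one_smul, skewW]

theorem symFour_mul_skewNet_mul_transpose (p q r s : R) (c : Fin 3 → R) :
    symFour p q r s * skewNet (c ᵥ* symTwo p q r s) * (symFour p q r s)ᵀ =
      (p * s - q * r) ^ 5 • skewNet c := by
  have hc : c ᵥ* symTwo p q r s = ![c 0 * p ^ 2 + c 1 * (2 * p * r) + c 2 * r ^ 2,
      c 0 * (p * q) + c 1 * (p * s + q * r) + c 2 * (r * s),
      c 0 * q ^ 2 + c 1 * (2 * q * s) + c 2 * s ^ 2] := by
    ext l
    fin_cases l <;> simp [Matrix.vecMul, dotProduct, Fin.sum_univ_three, symTwo]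
  ext i j
  rw [mul_skewNet_mul_transpose_apply, hc, Matrix.smul_apply, smul_eq_mul]
  fin_cases i <;> fin_cases j <;>
  · simp only [symFour, skewNet, Fin.isValue, Fin.reduceFinMk, Fin.mk_one, Fin.zero_eta,
      Matrix.of_apply, Matrix.cons_val', Matrix.cons_val]
    ring

theorem rhoGL_mem_stabilizerW (x : GL (Fin 2) R) : rhoGL R x ∈ stabilizerW R := by
  rw [mem_stabilizerW_iff]
  intro l
  have hd : x 0 0 * x 1 1 - x 0 1 * x 1 0 = x.det := (Matrix.det_fin_two _).symm
  have hunit :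
      ((x.det⁻¹ ^ 2 : Rˣ) : R) * ((x.det⁻¹ : Rˣ) * (x.det⁻¹ ^ 2 : Rˣ) * x.det ^ 5) = 1 := by
    rw [← Units.val_pow_eq_pow_val, ← Units.val_mul, ← Units.val_mul, ← Units.val_mul,
      Units.val_eq_one]
    group
  simp only [orbitMatrix, rhoGL_fst, rhoGL_snd, Matrix.vecMul_smul, skewNet_smul,
    Matrix.transpose_smul, Matrix.smul_mul, Matrix.mul_smul, symFour_mul_skewNet_mul_transpose,
    smul_smul, hd]
  rw [hunit, one_smul, skewW]

end Equations

section Discriminant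

variable {R : Type*} [CommRing R]

/-- The coefficient at `mₐ ∧ m_b ∧ m_c ∧ m_d` of the exterior product of the bivectors with
skew-symmetric coefficient matrices `A` and `B`. -/
def wedgeCoord {n : Type*} (A B : Matrix n n R) (a b c d : n) : R :=
  A a b * B c d - A a c * B b d + A a d * B b c + A b c * B a d - A b d * B a c + A c d * B a b

/-- The relation `ω₁ ∧ ω₁ = 4 ω₀ ∧ ω₂` transported by `g`, where `w = ∑ₗ ωₗ ⊗ lₗ`. -/
theorem wedgeCoord_mul_skewW_mul_transpose {n : Type*} (g : Matrix n (Fin 5) R) (a b c d : n) :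
    wedgeCoord (g * skewW R 1 * gᵀ) (g * skewW R 1 * gᵀ) a b c d =
      4 * wedgeCoord (g * skewW R 0 * gᵀ) (g * skewW R 2 * gᵀ) a b c d := by
  simp only [wedgeCoord, skewW, mul_skewNet_mul_transpose_apply, Pi.single_apply, Fin.isValue,
    Fin.reduceEq, ↓reduceIte]
  ring

/-- The discriminant of the binary quadratic form `y₀ e₁² + y₁ e₁ e₂ + y₂ e₂²`. -/
def discr (y : Fin 3 → R) : R := y 1 ^ 2 - 4 * y 0 * y 2

/-- Matrices which multiply the discriminant of binary quadratic forms by a constant. -/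
def IsDiscrSimilitude (h : Matrix (Fin 3) (Fin 3) R) : Prop :=
  ∃ μ : R, ∀ y, discr (h *ᵥ y) = μ * discr y

theorem isDiscrSimilitude_iff {h : Matrix (Fin 3) (Fin 3) R} :
    IsDiscrSimilitude h ↔
      h 1 0 ^ 2 = 4 * h 0 0 * h 2 0 ∧
      2 * (h 1 0 * h 1 1) = 4 * (h 0 0 * h 2 1 + h 0 1 * h 2 0) ∧
      2 * (h 1 0 * h 1 2) - 4 * (h 0 0 * h 2 2 + h 0 2 * h 2 0) +
        4 * (h 1 1 ^ 2 - 4 * h 0 1 * h 2 1) = 0 ∧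
      2 * (h 1 1 * h 1 2) = 4 * (h 0 1 * h 2 2 + h 0 2 * h 2 1) ∧
      h 1 2 ^ 2 = 4 * h 0 2 * h 2 2 := by
  simp only [IsDiscrSimilitude, discr, Matrix.mulVec, dotProduct, Fin.sum_univ_three]
  constructor
  · rintro ⟨μ, hμ⟩
    have at100 := hμ ![1, 0, 0]
    have at010 := hμ ![0, 1, 0]
    have at001 := hμ ![0, 0, 1]
    have at110 := hμ ![1, 1, 0]
    have at101 := hμ ![1, 0, 1]
    have at011 := hμ ![0, 1, 1]
    simp only [Matrix.cons_val] at at100 at010 at001 at110 at101 at011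
    refine ⟨?_, ?_, ?_, ?_, ?_⟩
    · linear_combination at100
    · linear_combination at110 - at100 - at010
    · linear_combination at101 - at100 - at001 + 4 * at010
    · linear_combination at011 - at010 - at001
    · linear_combination at001
  · rintro ⟨h00, h01, h02, h12, h22⟩
    refine ⟨h 1 1 ^ 2 - 4 * h 0 1 * h 2 1, fun y => ?_⟩
    linear_combination y 0 ^ 2 * h00 + y 0 * y 1 * h01 + y 0 * y 2 * h02 + y 1 * y 2 * h12 +
      y 2 ^ 2 * h22

theorem wedgeCoord_skewNet_row {g : G R} (hg : g ∈ stabilizerW R) (a b c d : Fin 5) :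
    wedgeCoord (skewNet (g.2.1.row 1)) (skewNet (g.2.1.row 1)) a b c d =
      4 * wedgeCoord (skewNet (g.2.1.row 0)) (skewNet (g.2.1.row 2)) a b c d := by
  have hinv (l : Fin 3) :
      skewNet (g.2.1.row l) = g⁻¹.1.1 * skewW R l * g⁻¹.1.1ᵀ := by
    rw [← mem_stabilizerW_iff.1 hg l, orbitMatrix, Matrix.single_one_vecMul]
    have hleft : g⁻¹.1.1 * g.1.1 = 1 := Units.inv_mul g.1
    have hright : g.1.1ᵀ * g⁻¹.1.1ᵀ = 1 := by
      rw [← Matrix.transpose_mul, hleft, Matrix.transpose_one]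
    rw [← Matrix.mul_assoc, ← Matrix.mul_assoc, hleft, Matrix.one_mul, Matrix.mul_assoc, hright,
      Matrix.mul_one]
  simp only [hinv, wedgeCoord_mul_skewW_mul_transpose]

theorem isDiscrSimilitude_snd (hu2 : IsUnit (2 : R)) (hu3 : IsUnit (3 : R)) {g : G R}
    (hg : g ∈ stabilizerW R) : IsDiscrSimilitude (g.2 : Matrix (Fin 3) (Fin 3) R) := by
  have h6 : IsUnit (6 : R) := by convert hu2.mul hu3; norm_num
  have hwedge := wedgeCoord_skewNet_row hg
  have at1234 := hwedge 1 2 3 4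
  have at0234 := hwedge 0 2 3 4
  have at0134 := hwedge 0 1 3 4
  have at0124 := hwedge 0 1 2 4
  have at0123 := hwedge 0 1 2 3
  simp only [wedgeCoord, skewNet, Matrix.row_apply, Matrix.of_apply, Matrix.cons_val',
    Matrix.cons_val] at at1234 at0234 at0134 at0124 at0123
  rw [isDiscrSimilitude_iff]
  refine ⟨h6.mul_left_cancel ?_, hu3.mul_left_cancel ?_, ?_, hu3.mul_left_cancel ?_,
    h6.mul_left_cancel ?_⟩
  · linear_combination -at1234
  · linear_combination at0234
  · linear_combination -at0134
  · linear_combination at0124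
  · linear_combination -at0123

theorem IsDiscrSimilitude.notMem_or_notMem {h : Matrix (Fin 3) (Fin 3) R}
    (hh : IsDiscrSimilitude h) (hdet : IsUnit h.det) (p : Ideal R) [p.IsPrime] :
    h 0 0 ∉ p ∨ h 2 0 ∉ p := by
  by_contra! hmem
  obtain ⟨h00_mem, h20_mem⟩ := hmem
  have h10_mem : h 1 0 ∈ p := by
    apply Ideal.IsPrime.mem_of_pow_mem ‹p.IsPrime› 2
    rw [(isDiscrSimilitude_iff.1 hh).1]
    exact p.mul_mem_left _ h20_mem
  refine Ideal.IsPrime.ne_top ‹p.IsPrime› (p.eq_top_of_isUnit_mem ?_ hdet)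
  rw [h.det_succ_column_zero, Fin.sum_univ_three]
  refine add_mem (add_mem ?_ ?_) ?_
  all_goals exact p.mul_mem_right _ (p.mul_mem_left _ (by assumption))

theorem IsDiscrSimilitude.exists_eq_smul_symTwo (hu2 : IsUnit (2 : R))
    {h : Matrix (Fin 3) (Fin 3) R} (hh : IsDiscrSimilitude h) (hdet : IsUnit h.det)
    (h00 : IsUnit (h 0 0)) :
    ∃ q r s : R, IsUnit (s - q * r) ∧ h = h 0 0 • symTwo 1 q r s := by
  obtain ⟨e00, e01, e02, e12, e22⟩ := isDiscrSimilitude_iff.1 hh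
  generalize ha : h 0 0 = a at *
  have h4 : IsUnit (4 : R) := by convert hu2.mul hu2; norm_num
  have cancel {x y : R} (hxy : 4 * a ^ 2 * x = 4 * a ^ 2 * y) : x = y :=
    (h4.mul (h00.pow 2)).mul_left_cancel hxy
  obtain ⟨r, h10⟩ : 2 * a ∣ h 1 0 := (hu2.mul h00).dvd
  obtain ⟨q, h01⟩ : a ∣ h 0 1 := h00.dvd
  obtain ⟨s, h11⟩ : a ∣ h 1 1 - a * q * r := h00.dvd
  obtain ⟨u, h02⟩ : a ∣ h 0 2 := h00.dvd
  obtain ⟨v, h12⟩ : a ∣ h 1 2 := h00.dvd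
  obtain ⟨t, h22⟩ : a ∣ h 2 2 := h00.dvd
  rw [sub_eq_iff_eq_add] at h11
  rw [h10] at e00
  have h20 : h 2 0 = a * r ^ 2 :=
    cancel (by linear_combination -a * e00)
  rw [h10, h11, h01, h20] at e01
  have h21 : h 2 1 = a * (r * s) := cancel (by linear_combination -a * e01)
  rw [h10, h11, h12, h22, h02, h20, h01, h21] at e02
  have ht : t = r * v - r ^ 2 * u + (s - q * r) ^ 2 := cancel (by linear_combination -e02)
  rw [h.det_fin_three, h10, h11, h12, h20, h21, h22, h01, h02, ha, ht] at hdet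
  have hδ : IsUnit (s - q * r) := isUnit_of_dvd_unit ⟨a ^ 3 * (s - q * r) ^ 2, by ring⟩ hdet
  rw [h11, h12, h22, h01, h02, h21, ht] at e12
  have hv : v = 2 * (r * u + q * (s - q * r)) :=
    hδ.mul_left_cancel (cancel (by linear_combination 2 * e12))
  rw [h12, h02, h22, ht, hv] at e22
  have hu : u = q ^ 2 :=
    (hδ.pow 2).mul_left_cancel (cancel (by linear_combination -e22))
  refine ⟨q, r, s, hδ, ?_⟩
  ext i j
  fin_cases i <;> fin_cases j <;>
    simp only [ha, h10, h11, h12, h20, h21, h22, h01, h02, ht, hv, hu, symTwo, Fin.isValue,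
      Fin.reduceFinMk, Fin.mk_one, Fin.zero_eta, Matrix.smul_apply, Matrix.of_apply,
      Matrix.cons_val', Matrix.cons_val, smul_eq_mul] <;>
    ring

end Discriminant

section Intertwiners

variable {R : Type*} [CommRing R]

theorem isDiag_of_mul_skewW (hu3 : IsUnit (3 : R)) {A B : Matrix (Fin 5) (Fin 5) R}
    (h : ∀ l, A * skewW R l = skewW R l * B) : A.IsDiag := by
  have entry (l : Fin 3) (i j : Fin 5) :
      ∑ k, A i k * skewW R l k j = ∑ k, skewW R l i k * B k j := by
    simpa only [Matrix.mul_apply] using congrFun₂ (h l) i j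
  simp only [Fin.sum_univ_five, skewW, skewNet] at entry
  have cancel {x : R} : 3 * x = 0 ↔ x = 0 := hu3.mul_right_eq_zero
  have b10 : B 1 0 = 0 := by simpa using entry 0 4 0
  have b30 : B 3 0 = 0 := by simpa [cancel] using entry 0 2 0
  have b34 : B 3 4 = 0 := by simpa using (entry 2 0 4).symm
  have b14 : B 1 4 = 0 := by simpa [cancel] using (entry 2 2 4).symm
  have a01 : A 0 1 = 0 := by simpa using entry 0 0 4
  have a02 : A 0 2 = 0 := by simpa [mul_comm, cancel] using entry 0 0 3
  have a03 : A 0 3 = 0 := by simpa [mul_comm, cancel] using entry 0 0 2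
  have a04 : A 0 4 = 0 := by simpa using entry 0 0 1
  have a40 : A 4 0 = 0 := by simpa using entry 2 4 3
  have a41 : A 4 1 = 0 := by simpa [mul_comm, cancel] using entry 2 4 2
  have a42 : A 4 2 = 0 := by simpa [mul_comm, cancel] using entry 2 4 1
  have a43 : A 4 3 = 0 := by simpa using entry 2 4 0
  have a20 : A 2 0 = 0 := by simpa using entry 1 2 4
  have a24 : A 2 4 = 0 := by simpa using entry 1 2 0
  have a21 : A 2 1 = 0 := by simpa [b34] using entry 0 2 4
  have a23 : A 2 3 = 0 := by simpa [b10] using entry 2 2 0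
  have a10 : A 1 0 = 0 := by simpa [b34] using entry 1 1 4
  have a14 : A 1 4 = 0 := by simpa [b30] using entry 1 1 0
  have a34 : A 3 4 = 0 := by simpa [b10] using entry 1 3 0
  have a30 : A 3 0 = 0 := by simpa [b14] using entry 1 3 4
  have b42 : B 4 2 = 0 := by simpa using entry 1 0 2
  have b02 : B 0 2 = 0 := by simpa using (entry 1 4 2).symm
  have b43 : B 4 3 = 0 := by simpa [a01] using entry 1 0 3
  have b01 : B 0 1 = 0 := by simpa [a43] using (entry 1 4 1).symm
  have a13 : A 1 3 = 0 := by simpa [mul_comm, cancel, b42] using entry 0 1 2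
  have a12 : A 1 2 = 0 := by simpa [mul_comm, cancel, b43] using entry 0 1 3
  have a31 : A 3 1 = 0 := by simpa [mul_comm, cancel, b02] using entry 2 3 2
  have a32 : A 3 2 = 0 := by simpa [mul_comm, cancel, b01] using entry 2 3 1
  intro i j hij
  fin_cases i <;> fin_cases j <;> first | assumption | exact absurd rfl hij

theorem eq_smul_one_of_mul_skewW (hu3 : IsUnit (3 : R)) {A B : Matrix (Fin 5) (Fin 5) R}
    (h : ∀ l, A * skewW R l = skewW R l * B) : A = A 0 0 • (1 : Matrix (Fin 5) (Fin 5) R) := by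
  have entry (l : Fin 3) (i j : Fin 5) :
      ∑ k, A i k * skewW R l k j = ∑ k, skewW R l i k * B k j := by
    simpa only [Matrix.mul_apply] using congrFun₂ (h l) i j
  simp only [Fin.sum_univ_five, skewW, skewNet] at entry
  have a00 : A 0 0 = B 3 3 := by simpa using entry 2 0 3
  have a22 : A 2 2 = B 3 3 := hu3.mul_left_cancel (by simpa [mul_comm] using entry 0 2 3)
  have a22' : A 2 2 = B 1 1 := hu3.mul_left_cancel (by simpa [mul_comm] using entry 2 2 1)
  have a44 : A 4 4 = B 1 1 := by simpa using entry 0 4 1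
  have a44' : A 4 4 = B 0 0 := by simpa using entry 1 4 0
  have a33 : A 3 3 = B 0 0 := by simpa using entry 2 3 0
  have a00' : A 0 0 = B 4 4 := by simpa using entry 1 0 4
  have a11 : A 1 1 = B 4 4 := by simpa using entry 0 1 4
  have diag (i : Fin 5) : A i i = A 0 0 := by
    fin_cases i
    · rfl
    · exact a11.trans a00'.symm
    · exact a22.trans a00.symm
    · exact (((a33.trans a44'.symm).trans a44).trans a22'.symm).trans (a22.trans a00.symm)
    · exact (a44.trans a22'.symm).trans (a22.trans a00.symm)
  ext i j
  obtain rfl | hij := eq_or_ne i j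
  · simp [diag]
  · simp [isDiag_of_mul_skewW hu3 h hij, hij]

theorem exists_eq_tauT_of_snd_eq_smul_one (hu3 : IsUnit (3 : R)) {g : G R}
    (hg : g ∈ stabilizerW R) {z : Rˣ}
    (hz : (g.2 : Matrix (Fin 3) (Fin 3) R) = (z : R) • (1 : Matrix (Fin 3) (Fin 3) R)) :
    ∃ t, g = tauT R t := by
  have hfix (l : Fin 3) : (z : R) • (g.1.1 * skewW R l * g.1.1ᵀ) = skewW R l := by
    conv_rhs => rw [← mem_stabilizerW_iff.1 hg l]
    rw [orbitMatrix, hz, Matrix.vecMul_smul, Matrix.vecMul_one, skewNet_smul, Matrix.mul_smul,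
      Matrix.smul_mul, skewW]
  have hintertwines (l : Fin 3) :
      g.1.1 * skewW R l = skewW R l * (((z⁻¹ : Rˣ) : R) • g⁻¹.1.1ᵀ) := by
    have hright : g.1.1ᵀ * g⁻¹.1.1ᵀ = 1 := by
      rw [← Matrix.transpose_mul, ← Matrix.transpose_one]
      exact congrArg Matrix.transpose (Units.inv_mul g.1)
    conv_rhs => rw [← hfix l]
    rw [Matrix.smul_mul, Matrix.mul_smul, smul_smul, z.mul_inv, one_smul, Matrix.mul_assoc, hright,
      Matrix.mul_one]
  have hfst := eq_smul_one_of_mul_skewW hu3 hintertwines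
  have hunit : (z : R) * (g.1 0 0 * g.1 0 0) = 1 := by
    have entry := congrFun₂ (hfix 2) 0 3
    rw [hfst] at entry
    simpa [skewW, skewNet] using entry
  let t : Rˣ := ⟨g.1 0 0, z * g.1 0 0, by linear_combination hunit, by linear_combination hunit⟩
  have ht : z = t ^ (-2 : ℤ) := by
    rw [eq_inv_of_mul_eq_one_left (show z * (t * t) = 1 from Units.ext hunit)]
    group
  exact ⟨t, Prod.ext (Units.ext (by rw [tauT_fst]; exact hfst))
    (Units.ext (by rw [tauT_snd, hz, ht]))⟩

theorem exists_rhoGL_mul_tauT_of_isUnit_zero (hu2 : IsUnit (2 : R)) (hu3 : IsUnit (3 : R))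
    {g : G R} (hg : g ∈ stabilizerW R) (h00 : IsUnit (g.2 0 0)) :
    ∃ x t, g = rhoGL R x * tauT R t := by
  have hdet : IsUnit (g.2 : Matrix (Fin 3) (Fin 3) R).det :=
    (Matrix.isUnit_iff_isUnit_det _).1 g.2.isUnit
  obtain ⟨q, r, s, hδ, hsnd⟩ :=
    (isDiscrSimilitude_snd hu2 hu3 hg).exists_eq_smul_symTwo hu2 hdet h00
  let x : GL (Fin 2) R := Matrix.GeneralLinearGroup.mk'' !![1, q; r, s]
    (by rwa [Matrix.det_fin_two_of, one_mul])
  let z : Rˣ := h00.unit * x.det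
  have hrho : (rhoGL R x).2.1 = ((x.det⁻¹ : Rˣ) : R) • symTwo 1 q r s := rhoGL_snd x
  have hz : g.2.1 = (z : R) • (rhoGL R x).2.1 := by
    rw [hrho, smul_smul, ← Units.val_mul, mul_inv_cancel_right]
    exact hsnd
  obtain ⟨t, ht⟩ := exists_eq_tauT_of_snd_eq_smul_one hu3
    (mul_mem (inv_mem (rhoGL_mem_stabilizerW x)) hg) (z := z) (by
      rw [Prod.snd_mul, Units.val_mul, hz, Matrix.mul_smul, Prod.snd_inv, Units.inv_mul])
  exact ⟨x, t, by rw [← ht, mul_inv_cancel_left]⟩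

theorem exists_rhoGL_mul_tauT_of_isUnit_two (hu2 : IsUnit (2 : R)) (hu3 : IsUnit (3 : R))
    {g : G R} (hg : g ∈ stabilizerW R) (h20 : IsUnit (g.2 2 0)) :
    ∃ x t, g = rhoGL R x * tauT R t := by
  let y : GL (Fin 2) R := Matrix.GeneralLinearGroup.mk'' !![0, -1; 1, 0] (by simp)
  have hy : y.det = 1 := Units.ext (by simp [y])
  have h00 : (rhoGL R y * g).2 0 0 = g.2 2 0 := by
    rw [Prod.snd_mul, Matrix.GeneralLinearGroup.coe_mul, rhoGL_snd, hy]
    simp [y, symTwo, Matrix.mul_apply, Fin.sum_univ_three]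
  obtain ⟨x, t, hxt⟩ := exists_rhoGL_mul_tauT_of_isUnit_zero hu2 hu3
    (mul_mem (rhoGL_mem_stabilizerW y) hg) (by rwa [h00])
  refine ⟨y⁻¹ * x, t, ?_⟩
  rw [map_mul, mul_assoc, ← hxt, map_inv, inv_mul_cancel_left]

end Intertwiners

section DeterminantCharacter

variable {R S : Type*} [CommRing R] [CommRing S]

theorem det_symTwo (p q r s : R) : (symTwo p q r s).det = (p * s - q * r) ^ 3 := by
  simp only [Matrix.det_fin_three, symTwo, Matrix.of_apply, Matrix.cons_val', Matrix.cons_val]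
  ring

theorem det_symFour (p q r s : R) : (symFour p q r s).det = (p * s - q * r) ^ 10 := by
  rw [Matrix.det_succ_row_zero, Fin.sum_univ_five]
  simp only [symFour, Matrix.det_succ_row_zero (n := 3), Fin.sum_univ_four, Matrix.det_fin_three,
    Matrix.submatrix_apply, Matrix.of_apply, Matrix.cons_val', Matrix.cons_val, Fin.succAbove,
    Fin.isValue, Fin.reduceSucc, Fin.reduceCastSucc, Fin.reduceLT, ↓reduceIte,
    Fin.coe_ofNat_eq_mod, lt_self_iff_false]
  ring

theorem det_rhoGL_fst (x : GL (Fin 2) R) : (rhoGL R x).1.det = 1 := by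
  ext
  change (rhoGL R x).1.1.det = 1
  rw [rhoGL_fst, Matrix.det_smul, det_symFour, ← Matrix.det_fin_two,
    ← Matrix.GeneralLinearGroup.val_det_apply, ← Units.val_pow_eq_pow_val,
    ← Units.val_pow_eq_pow_val, ← Units.val_mul, ← pow_mul, Fintype.card_fin]
  simp

theorem det_rhoGL_snd (x : GL (Fin 2) R) : (rhoGL R x).2.det = 1 := by
  ext
  change (rhoGL R x).2.1.det = 1
  rw [rhoGL_snd, Matrix.det_smul, det_symTwo, ← Matrix.det_fin_two,
    ← Matrix.GeneralLinearGroup.val_det_apply, ← Units.val_pow_eq_pow_val,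
    ← Units.val_pow_eq_pow_val, ← Units.val_mul, Fintype.card_fin]
  simp

/-- The character `(g, h) ↦ (det g · det h)⁻¹` of `G`. It is trivial on `PGL(2)` and splits
`GL(1) ≅ T̃`, hence separates the two factors of `PGL(2) × T̃`. -/
def detChar (R : Type*) [CommRing R] : G R →* Rˣ :=
  (Matrix.GeneralLinearGroup.det.coprod Matrix.GeneralLinearGroup.det)⁻¹

theorem detChar_apply (g : G R) : detChar R g = (g.1.det * g.2.det)⁻¹ := rfl

theorem detChar_rhoGL (x : GL (Fin 2) R) : detChar R (rhoGL R x) = 1 := by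
  rw [detChar_apply, det_rhoGL_fst, det_rhoGL_snd, mul_one, inv_one]

theorem detChar_tauT (t : Rˣ) : detChar R (tauT R t) = t := by
  change ((Matrix.GeneralLinearGroup.scalar (Fin 5) t).det *
    (Matrix.GeneralLinearGroup.scalar (Fin 3) (t ^ (-2 : ℤ))).det)⁻¹ = t
  rw [Matrix.GeneralLinearGroup.det_scalar, Matrix.GeneralLinearGroup.det_scalar,
    Fintype.card_fin, Fintype.card_fin]
  group

theorem detChar_mapG (f : R →+* S) (g : G R) :
    detChar S (mapG f g) = Units.map (f : R →* S) (detChar R g) := by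
  rw [detChar_apply, detChar_apply, map_inv, map_mul, ← Matrix.GeneralLinearGroup.map_det,
    ← Matrix.GeneralLinearGroup.map_det]
  rfl

theorem mapG_tauT (f : R →+* S) (t : Rˣ) :
    mapG f (tauT R t) = tauT S (Units.map (f : R →* S) t) := by
  refine Prod.ext (Matrix.GeneralLinearGroup.map_scalar f t) ?_
  refine (Matrix.GeneralLinearGroup.map_scalar f (t ^ (-2 : ℤ))).trans ?_
  rw [map_zpow]
  rfl

theorem tauT_injective : Function.Injective (tauT R) :=
  Function.LeftInverse.injective detChar_tauT

theorem mem_range_scalar_of_symTwo_eq_smul_one {p q r s : R} {c : Rˣ}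
    (h : symTwo p q r s = (c : R) • (1 : Matrix (Fin 3) (Fin 3) R)) :
    !![p, q; r, s] ∈ Set.range (Matrix.scalar (Fin 2)) := by
  have entry (i j : Fin 3) := congrFun₂ h i j
  have h00 : p ^ 2 = c := by simpa [symTwo] using entry 0 0
  have h01 : p * q = 0 := by simpa [symTwo] using entry 0 1
  have h11 : p * s + q * r = c := by simpa [symTwo] using entry 1 1
  have h21 : r * s = 0 := by simpa [symTwo] using entry 2 1
  have h22 : s ^ 2 = c := by simpa [symTwo] using entry 2 2
  have hp : IsUnit p := (isUnit_pow_iff two_ne_zero).1 (h00 ▸ c.isUnit)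
  have hs : IsUnit s := (isUnit_pow_iff two_ne_zero).1 (h22 ▸ c.isUnit)
  have hq : q = 0 := hp.mul_right_eq_zero.1 h01
  have hr : r = 0 := hs.mul_left_eq_zero.1 h21
  have hps : p = s := hp.mul_left_cancel (by linear_combination h00 - h11 + r * hq)
  refine ⟨p, ?_⟩
  ext i j
  fin_cases i <;> fin_cases j <;> simp [hq, hr, hps]

theorem rhoPGL_injective : Function.Injective (rhoPGL R) := by
  rw [injective_iff_map_eq_one]
  intro x hx
  obtain ⟨y, rfl⟩ := Matrix.ProjGenLinGroup.mk_surjective x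
  have hsnd : (rhoGL R y).2.1 = 1 := congrArg (fun g => g.2.1) hx
  rw [Matrix.ProjGenLinGroup.mk_eq_one,
    Matrix.GeneralLinearGroup.mem_center_iff_val_mem_range_scalar, Matrix.eta_fin_two y.1]
  apply mem_range_scalar_of_symTwo_eq_smul_one (c := y.det)
  rw [← hsnd, rhoGL_snd, smul_smul, ← Units.val_mul, mul_inv_cancel, Units.val_one, one_smul]

end DeterminantCharacter

section LocalGlobal

variable {R : Type*} [CommRing R]

theorem eq_of_forall_exists_away {a b : R} (h : ∀ p : PrimeSpectrum R, ∃ f ∉ p.asIdeal,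
    algebraMap R (Localization.Away f) a = algebraMap R (Localization.Away f) b) : a = b := by
  refine sub_eq_zero.1 (eq_zero_of_localization _ fun M hM => ?_)
  obtain ⟨f, hf, hab⟩ := h ⟨M, hM.isPrime⟩
  have hunit (c : Submonoid.powers f) : IsUnit (algebraMap R (Localization.AtPrime M) c) :=
    IsLocalization.map_units (M := M.primeCompl) _
      ⟨c, Submonoid.powers_le (P := M.primeCompl).2 hf c.2⟩
  rw [map_sub, sub_eq_zero, ← IsLocalization.lift_eq (S := Localization.Away f) hunit, hab,
    IsLocalization.lift_eq]

theorem pglSubgroup_le_stabilizerW : pglSubgroup R ≤ stabilizerW R := by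
  intro g hg
  rw [mem_stabilizerW_iff]
  intro l
  ext i j
  refine eq_of_forall_exists_away fun p => ?_
  obtain ⟨f, hf, x, hx⟩ := hg p
  obtain ⟨y, rfl⟩ := Matrix.ProjGenLinGroup.mk_surjective x
  refine ⟨f, hf, ?_⟩
  have hlocal : orbitMatrix (mapG (algebraMap R (Localization.Away f)) g) l = skewW _ l := by
    rw [hx]
    exact mem_stabilizerW_iff.1 (rhoGL_mem_stabilizerW y) l
  rw [orbitMatrix_mapG, ← skewW_map (algebraMap R _)] at hlocal
  exact congrFun₂ hlocal i j

theorem detChar_eq_one_of_mem_pglSubgroup {g : G R} (hg : g ∈ pglSubgroup R) :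
    detChar R g = 1 := by
  refine Units.ext (eq_of_forall_exists_away fun p => ?_)
  obtain ⟨f, hf, x, hx⟩ := hg p
  obtain ⟨y, rfl⟩ := Matrix.ProjGenLinGroup.mk_surjective x
  refine ⟨f, hf, ?_⟩
  have hlocal : detChar _ (mapG (algebraMap R (Localization.Away f)) g) = 1 := by
    rw [hx]
    exact detChar_rhoGL y
  rw [detChar_mapG] at hlocal
  simpa using congrArg Units.val hlocal

theorem pglSubgroup_inf_torusSubgroup : pglSubgroup R ⊓ torusSubgroup R = ⊥ := by
  rw [eq_bot_iff]
  rintro _ ⟨hpgl, t, rfl⟩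
  have ht := detChar_eq_one_of_mem_pglSubgroup hpgl
  rw [detChar_tauT] at ht
  rw [ht, map_one, Subgroup.mem_bot]

theorem corner_notMem_or_corner_notMem (hu2 : IsUnit (2 : R)) (hu3 : IsUnit (3 : R))
    {g : G R} (hg : g ∈ stabilizerW R) (p : Ideal R) [p.IsPrime] : g.2 0 0 ∉ p ∨ g.2 2 0 ∉ p :=
  (isDiscrSimilitude_snd hu2 hu3 hg).notMem_or_notMem
    ((Matrix.isUnit_iff_isUnit_det _).1 g.2.isUnit) p

theorem exists_rhoGL_mul_tauT_of_isUnit (hu2 : IsUnit (2 : R)) (hu3 : IsUnit (3 : R))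
    {g : G R} (hg : g ∈ stabilizerW R) (hcorner : IsUnit (g.2 0 0) ∨ IsUnit (g.2 2 0)) :
    ∃ x t, g = rhoGL R x * tauT R t :=
  hcorner.elim (exists_rhoGL_mul_tauT_of_isUnit_zero hu2 hu3 hg)
    (exists_rhoGL_mul_tauT_of_isUnit_two hu2 hu3 hg)

theorem exists_rhoGL_mul_tauT [IsLocalRing R] (hu2 : IsUnit (2 : R)) (hu3 : IsUnit (3 : R))
    {g : G R} (hg : g ∈ stabilizerW R) : ∃ x t, g = rhoGL R x * tauT R t := by
  refine exists_rhoGL_mul_tauT_of_isUnit hu2 hu3 hg ?_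
  simpa using corner_notMem_or_corner_notMem hu2 hu3 hg (IsLocalRing.maximalIdeal R)

theorem mul_inv_tauT_detChar_mem_pglSubgroup (hu2 : IsUnit (2 : R)) (hu3 : IsUnit (3 : R))
    {g : G R} (hg : g ∈ stabilizerW R) : g * (tauT R (detChar R g))⁻¹ ∈ pglSubgroup R := by
  intro p
  obtain ⟨f, hf, hcorner⟩ : ∃ f ∉ p.asIdeal, f = g.2 0 0 ∨ f = g.2 2 0 := by
    obtain h | h := corner_notMem_or_corner_notMem hu2 hu3 hg p.asIdeal
    exacts [⟨_, h, .inl rfl⟩, ⟨_, h, .inr rfl⟩]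
  let φ := algebraMap R (Localization.Away f)
  have hφf : IsUnit (φ f) := IsLocalization.Away.algebraMap_isUnit f
  obtain ⟨x, t, hxt⟩ := exists_rhoGL_mul_tauT_of_isUnit (g := mapG φ g)
    (by simpa only [map_ofNat] using hu2.map φ) (by simpa only [map_ofNat] using hu3.map φ)
    (mapG_mem_stabilizerW φ hg)
    (hcorner.imp (fun h => (congrArg φ h).subst hφf) fun h => (congrArg φ h).subst hφf)
  refine ⟨f, hf, .mk x, ?_⟩
  rw [map_mul, map_inv, mapG_tauT, ← detChar_mapG, hxt, map_mul, detChar_rhoGL, detChar_tauT,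
    one_mul, mul_inv_cancel_right]
  rfl

theorem mem_stabilizerW_iff_exists_mul (hu2 : IsUnit (2 : R)) (hu3 : IsUnit (3 : R)) {g : G R} :
    g ∈ stabilizerW R ↔ ∃ p ∈ pglSubgroup R, ∃ t ∈ torusSubgroup R, g = p * t := by
  constructor
  · intro hg
    exact ⟨_, mul_inv_tauT_detChar_mem_pglSubgroup hu2 hu3 hg, _, ⟨detChar R g, rfl⟩, by simp⟩
  · rintro ⟨p, hp, _, ⟨t, rfl⟩, rfl⟩
    exact mul_mem (pglSubgroup_le_stabilizerW hp) (tauT_mem_stabilizerW t)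

end LocalGlobal

section Connectedness

variable (k : Type*) [Field k]

theorem evalAt_mapG {R S : Type*} [CommRing R] [CommRing S] [Algebra k R] [Algebra k S]
    (f : R →ₐ[k] S) (g : G R) : evalAt k (mapG (f : R →+* S) g) = f.comp (evalAt k g) := by
  refine MvPolynomial.algHom_ext fun i => ?_
  rw [AlgHom.comp_apply, evalAt, evalAt, MvPolynomial.aeval_X, MvPolynomial.aeval_X]
  cases i <;> rfl

theorem exists_map_eq_of_isLocalHom {n K L : Type*} [Fintype n] [DecidableEq n] [CommRing K]
    [CommRing L] (ψ : K →+* L) [IsLocalHom ψ] {A : Matrix n n K} {γ : GL n L}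
    (h : A.map ψ = γ.1) : ∃ γ' : GL n K, γ'.1 = A ∧ Matrix.GeneralLinearGroup.map ψ γ' = γ := by
  have hdet : IsUnit A.det := by
    apply isUnit_of_map_unit ψ
    rw [RingHom.map_det]
    change IsUnit (A.map ψ).det
    rw [h]
    exact (Matrix.isUnit_iff_isUnit_det _).1 γ.isUnit
  exact ⟨Matrix.GeneralLinearGroup.mk'' A hdet, rfl, Units.ext h⟩

theorem exists_mapG_eq_of_comp_eq_evalAt {K L : Type*} [CommRing K] [CommRing L] [Algebra k K]
    [Algebra k L] (ψ : K →ₐ[k] L) [IsLocalHom (ψ : K →+* L)] (e : CoordRing k →ₐ[k] K) {g : G L}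
    (h : ψ.comp e = evalAt k g) :
    ∃ g' : G K, mapG (ψ : K →+* L) g' = g ∧ evalAt k g' = e := by
  have hX (i : (Fin 5 × Fin 5) ⊕ (Fin 3 × Fin 3)) :
      ψ (e (MvPolynomial.X i)) =
        Sum.elim (fun ij => g.1 ij.1 ij.2) (fun ij => g.2 ij.1 ij.2) i := by
    rw [← AlgHom.comp_apply, h, evalAt, MvPolynomial.aeval_X]
  obtain ⟨g₁, hA, hg₁⟩ := exists_map_eq_of_isLocalHom (ψ : K →+* L) (γ := g.1)
    (A := Matrix.of fun i j => e (MvPolynomial.X (Sum.inl (i, j))))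
    (Matrix.ext fun i j => hX (Sum.inl (i, j)))
  obtain ⟨g₂, hB, hg₂⟩ := exists_map_eq_of_isLocalHom (ψ : K →+* L) (γ := g.2)
    (A := Matrix.of fun i j => e (MvPolynomial.X (Sum.inr (i, j))))
    (Matrix.ext fun i j => hX (Sum.inr (i, j)))
  refine ⟨(g₁, g₂), Prod.ext hg₁ hg₂, MvPolynomial.algHom_ext fun i => ?_⟩
  rw [evalAt, MvPolynomial.aeval_X]
  rcases i with ⟨i, j⟩ | ⟨i, j⟩
  exacts [congrFun₂ hA i j, congrFun₂ hB i j]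

theorem comap_evalAt_mem_stabilizerSpace {R : Type*} [CommRing R] [Algebra k R] {g : G R}
    (hg : g ∈ stabilizerW R) (p : PrimeSpectrum R) :
    PrimeSpectrum.comap (evalAt k g).toRingHom p ∈ stabilizerSpace k := by
  let x := PrimeSpectrum.comap (evalAt k g).toRingHom p
  let ψ : x.asIdeal.ResidueField →ₐ[k] p.asIdeal.ResidueField :=
    Ideal.ResidueField.mapₐ x.asIdeal p.asIdeal (evalAt k g) rfl
  let e := IsScalarTower.toAlgHom k (CoordRing k) x.asIdeal.ResidueField
  let ι := IsScalarTower.toAlgHom k R p.asIdeal.ResidueField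
  obtain ⟨g', hg', he⟩ := exists_mapG_eq_of_comp_eq_evalAt k ψ e (g := mapG (ι : R →+* _) g) <| by
    rw [evalAt_mapG]
    exact AlgHom.ext fun f => Ideal.ResidueField.map_algebraMap ..
  have hψ : Function.Injective (ψ : x.asIdeal.ResidueField →+* p.asIdeal.ResidueField) :=
    RingHom.injective _
  refine ⟨g', mem_stabilizerW_of_mapG hψ ?_, fun f => DFunLike.congr_fun he f⟩
  rw [hg']
  exact mapG_mem_stabilizerW _ hg

/-- The polynomial ring on the entries of the generic `2 × 2` matrix and on the generic scalar. -/
abbrev GenericPoly : Type _ := MvPolynomial ((Fin 2 × Fin 2) ⊕ Unit) k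

/-- The generic `2 × 2` matrix. -/
def genericMatrix : Matrix (Fin 2) (Fin 2) (GenericPoly k) :=
  Matrix.of fun i j => MvPolynomial.X (Sum.inl (i, j))

/-- The polynomial whose nonvanishing defines `GL(2) × GL(1)` in the space of pairs of a
`2 × 2` matrix and a scalar. -/
def genericDenom : GenericPoly k := (genericMatrix k).det * MvPolynomial.X (Sum.inr ())

/-- The coordinate ring of `GL(2) × GL(1)`. -/
abbrev GenericRing : Type _ := Localization.Away (genericDenom k)

theorem genericDenom_ne_zero : genericDenom k ≠ 0 := by
  intro h
  have hone := congrArg (MvPolynomial.aeval (R := k) (S₁ := k)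
    (Sum.elim (fun ij => (1 : Matrix (Fin 2) (Fin 2) k) ij.1 ij.2) fun _ => 1)) h
  simp [genericDenom, genericMatrix, Matrix.det_fin_two] at hone

instance : IsDomain (GenericRing k) :=
  IsLocalization.isDomain_localization
    (powers_le_nonZeroDivisors_of_noZeroDivisors (genericDenom_ne_zero k))

theorem isUnit_algebraMap_det_and_scalar :
    IsUnit (algebraMap (GenericPoly k) (GenericRing k) (genericMatrix k).det) ∧
      IsUnit (algebraMap (GenericPoly k) (GenericRing k) (MvPolynomial.X (Sum.inr ()))) := by
  rw [← IsUnit.mul_iff, ← map_mul]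
  exact IsLocalization.Away.algebraMap_isUnit (genericDenom k)

/-- The universal point of `GL(2)` over the coordinate ring of `GL(2) × GL(1)`. -/
def genericGL : GL (Fin 2) (GenericRing k) :=
  Matrix.GeneralLinearGroup.mk''
    ((algebraMap (GenericPoly k) (GenericRing k)).mapMatrix (genericMatrix k))
    (RingHom.map_det (algebraMap (GenericPoly k) (GenericRing k)) (genericMatrix k) ▸
      (isUnit_algebraMap_det_and_scalar k).1)

/-- The universal point of `GL(1)` over the coordinate ring of `GL(2) × GL(1)`. -/
def genericScalar : (GenericRing k)ˣ := (isUnit_algebraMap_det_and_scalar k).2.unit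

/-- The universal point of `PGL(2) · T̃`: every `ρ(x) τ(t)` is a specialization of it. -/
def genericG : G (GenericRing k) :=
  rhoGL _ (genericGL k) * tauT _ (genericScalar k)

theorem exists_algHom_mapG_genericG_eq {S : Type*} [CommRing S] [Algebra k S]
    (x : GL (Fin 2) S) (t : Sˣ) :
    ∃ χ : GenericRing k →ₐ[k] S,
      mapG (χ : GenericRing k →+* S) (genericG k) = rhoGL S x * tauT S t := by
  let φ : GenericPoly k →ₐ[k] S :=
    MvPolynomial.aeval (Sum.elim (fun ij => x ij.1 ij.2) fun _ => (t : S))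
  have hφX (i) : φ (MvPolynomial.X i) = Sum.elim (fun ij => x ij.1 ij.2) (fun _ => (t : S)) i :=
    MvPolynomial.aeval_X _ i
  have hφ_matrix : φ.mapMatrix (genericMatrix k) = x.1 :=
    Matrix.ext fun i j => hφX (Sum.inl (i, j))
  have hφ_denom : IsUnit (φ (genericDenom k)) := by
    rw [genericDenom, map_mul, AlgHom.map_det, hφ_matrix, hφX]
    exact ((Matrix.isUnit_iff_isUnit_det _).1 x.isUnit).mul t.isUnit
  let χ : GenericRing k →ₐ[k] S := IsLocalization.Away.liftAlgHom (genericDenom k) hφ_denom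
  have hχ (a : GenericPoly k) : χ (algebraMap _ _ a) = φ a :=
    IsLocalization.Away.lift_eq _ hφ_denom a
  have hχ_GL : Matrix.GeneralLinearGroup.map (χ : GenericRing k →+* S) (genericGL k) = x :=
    Units.ext (Eq.trans (Matrix.ext fun i j => hχ _) hφ_matrix)
  have hχ_scalar :
      Units.map ((χ : GenericRing k →+* S) : GenericRing k →* S) (genericScalar k) = t :=
    Units.ext ((hχ _).trans (hφX (Sum.inr ())))
  exact ⟨χ, by rw [genericG, map_mul, ← rhoGL_map, mapG_tauT, hχ_GL, hχ_scalar]⟩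

variable {k}

theorem isUnit_ofNat_of_algebra {n : ℕ} [n.AtLeastTwo] (h : (OfNat.ofNat n : k) ≠ 0) (R : Type*)
    [CommRing R] [Algebra k R] : IsUnit (OfNat.ofNat n : R) := by
  simpa only [map_ofNat] using h.isUnit.map (algebraMap k R)

theorem isPreconnected_stabilizerSpace (h2 : (2 : k) ≠ 0) (h3 : (3 : k) ≠ 0) :
    IsPreconnected (stabilizerSpace k) := by
  let η := PrimeSpectrum.comap (evalAt k (genericG k)).toRingHom ⊥
  have hη : η ∈ stabilizerSpace k :=
    comap_evalAt_mem_stabilizerSpace k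
      (mul_mem (rhoGL_mem_stabilizerW _) (tauT_mem_stabilizerW _)) ⊥
  suffices hdense : stabilizerSpace k ⊆ closure {η} from
    isPreconnected_singleton.subset_closure (Set.singleton_subset_iff.2 hη) hdense
  rintro y ⟨g, hg, hgy⟩
  obtain ⟨x, t, rfl⟩ := exists_rhoGL_mul_tauT (isUnit_ofNat_of_algebra h2 _)
    (isUnit_ofNat_of_algebra h3 _) hg
  obtain ⟨χ, hχ⟩ := exists_algHom_mapG_genericG_eq k x t
  rw [← PrimeSpectrum.le_iff_mem_closure]
  intro f hf
  have hf_generic : evalAt k (genericG k) f = 0 := hf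
  rw [← Ideal.algebraMap_residueField_eq_zero, ← hgy, ← hχ, evalAt_mapG, AlgHom.comp_apply,
    hf_generic, map_zero]

theorem identityComponent_eq_stabilizerW (h2 : (2 : k) ≠ 0) (h3 : (3 : k) ≠ 0) (R : Type*)
    [CommRing R] [Algebra k R] : identityComponent k R = stabilizerW R := by
  have hspace : identityComponentSpace k = stabilizerSpace k :=
    (isPreconnected_stabilizerSpace h2 h3).connectedComponentIn
      (comap_evalAt_mem_stabilizerSpace k (one_mem _) ⊥)
  ext g
  refine ⟨fun hg => hg.1, fun hg => ⟨hg, fun p => ?_⟩⟩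
  rw [hspace]
  exact comap_evalAt_mem_stabilizerSpace k hg p

end Connectedness

end GLFiveGLThree

end

theorem mainTheorem6_general (k : Type*) [Field k] (h2 : (2 : k) ≠ 0) (h3 : (3 : k) ≠ 0)
    (R : Type*) [CommRing R] [Algebra k R] :
    GLFiveGLThree.identityComponent k R =
        {g | ∃ p ∈ GLFiveGLThree.pglSubgroup R, ∃ t ∈ GLFiveGLThree.torusSubgroup R,
          g = p * t} ∧
      (∀ p ∈ GLFiveGLThree.pglSubgroup R, ∀ t ∈ GLFiveGLThree.torusSubgroup R,
        p * t = t * p) ∧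
      GLFiveGLThree.pglSubgroup R ⊓ GLFiveGLThree.torusSubgroup R = ⊥ ∧
      Function.Injective (GLFiveGLThree.rhoPGL R) ∧
      Function.Injective (GLFiveGLThree.tauT R) ∧
      (IsLocalRing R → GLFiveGLThree.identityComponent k R =
        {g | ∃ (x : Matrix.ProjGenLinGroup (Fin 2) R) (t : Rˣ),
          g = GLFiveGLThree.rhoPGL R x * GLFiveGLThree.tauT R t}) := by
  have hu2 : IsUnit (2 : R) := GLFiveGLThree.isUnit_ofNat_of_algebra h2 R
  have hu3 : IsUnit (3 : R) := GLFiveGLThree.isUnit_ofNat_of_algebra h3 R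
  rw [GLFiveGLThree.identityComponent_eq_stabilizerW h2 h3]
  refine ⟨Set.ext fun _ => GLFiveGLThree.mem_stabilizerW_iff_exists_mul hu2 hu3, ?_,
    GLFiveGLThree.pglSubgroup_inf_torusSubgroup, GLFiveGLThree.rhoPGL_injective,
    GLFiveGLThree.tauT_injective, fun _ => Set.ext fun g => ⟨fun hg => ?_, ?_⟩⟩
  · rintro p - _ ⟨t, rfl⟩
    exact (GLFiveGLThree.tauT_commute t p).symm
  · obtain ⟨x, t, h⟩ := GLFiveGLThree.exists_rhoGL_mul_tauT hu2 hu3 hg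
    exact ⟨.mk x, t, h⟩
  · rintro ⟨x, t, rfl⟩
    obtain ⟨y, rfl⟩ := Matrix.ProjGenLinGroup.mk_surjective x
    exact mul_mem (GLFiveGLThree.rhoGL_mem_stabilizerW y) (GLFiveGLThree.tauT_mem_stabilizerW t)

theorem mainTheorem6 (k : Type*) [Field k] [CharZero k] (R : Type*) [CommRing R] [Algebra k R] :
    -- `G_w^0 = PGL(2) · T̃`, on points with values in an arbitrary `k`-algebra `R`
    GLFiveGLThree.identityComponent k R =
        {g | ∃ p ∈ GLFiveGLThree.pglSubgroup R, ∃ t ∈ GLFiveGLThree.torusSubgroup R,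
          g = p * t} ∧
      -- the product is direct
      (∀ p ∈ GLFiveGLThree.pglSubgroup R, ∀ t ∈ GLFiveGLThree.torusSubgroup R,
        p * t = t * p) ∧
      GLFiveGLThree.pglSubgroup R ⊓ GLFiveGLThree.torusSubgroup R = ⊥ ∧
      -- `PGL(2) → G` is an embedding, and `T̃ ≅ GL(1)`
      Function.Injective (GLFiveGLThree.rhoPGL R) ∧
      Function.Injective (GLFiveGLThree.tauT R) ∧
      -- in particular, the points of `G_w^0` over a field or a local ring
      (IsLocalRing R → GLFiveGLThree.identityComponent k R =
        {g | ∃ (x : Matrix.ProjGenLinGroup (Fin 2) R) (t : Rˣ),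
          g = GLFiveGLThree.rhoPGL R x * GLFiveGLThree.tauT R t}) :=
  mainTheorem6_general k two_ne_zero three_ne_zero R
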